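/- Let $X$ be a real Hilbert space. For a nonempty closed convex set $C\subseteq X$ let $P_C$ be the projector onto $C$ (so $P_Cx$ is the unique nearest point of $C$ to $x$) and $R_C=2P_C-\mathrm{Id}$. For nonempty closed convex sets $A,B\subseteq X$ put $$T=T_{(A,B)}=\mathrm{Id}-P_A+P_BR_A,\qquad g=g_{(A,B)}=P_{\overline{B-A}}\,0,\qquad B-A=\{b-a: b\in B,\ a\in A\}.$$ (i) Let $A$ be a nonempty closed affine subspace of $X$ and $B$ a nonempty closed convex subset of $X$ such that $g\in B-A$. (It is not assumed that $A\cap B\neq\varnothing$.) Then for every $x\in X$ the shadow sequence $(P_AT^nx)_{n\in\mathbb N}$ converges weakly to some point of $E=A\cap(B-g)$. (ii) Under the same assumptions, no general conclusion can be drawn about the boundedness of $(P_BT^nx)_{n\in\mathbb N}$: (a) If $A=B=X$, then $A$ and $B$ satisfy the assumptions of (i), and $(P_BT^nx)_{n\in\mathbb N}$ is bounded for every $x\in X$. (b) Let $X=\mathbb R^2$ with the Euclidean norm, $A=\mathbb R\times\{0\}$ and $B=\{(s,t)\in\mathbb R^2: |s|+1\le t\}$. Then $A$ and $B$ satisfy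 the assumptions of (i), $A\cap B=\varnothing$, and for every starting point $x\in[-1,1]\times\{0\}$ and every integer $n\ge 1$ we have $T^nx=(0,n)\in B$ and $\|P_BT^nx\|=n$. Hence $\|P_BT^nx\|\to\infty$. -/

import Mathlib

open scoped Pointwise Topology

namespace DouglasRachford

section Hilbert

variable {X : Type*} [NormedAddCommGroup X] [InnerProductSpace ℝ X]

/-- `p` is a best approximation of `x` from `C`. -/
def IsBestApprox (C : Set X) (x p : X) : Prop :=
  p ∈ C ∧ ∀ c ∈ C, ‖x - p‖ ≤ ‖x - c‖

open Classical in
/-- The projector `P_C`: the nearest point of `C` to `x`. It exists and is unique when `C` is a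
nonempty closed convex subset of a Hilbert space (see the next two lemmas); the value `0` for a
point without a nearest point is never used for such sets. -/
noncomputable def proj (C : Set X) (x : X) : X :=
  if h : ∃ p, IsBestApprox C x p then h.choose else 0

theorem isBestApprox_proj [CompleteSpace X] {C : Set X} (hne : C.Nonempty) (hcl : IsClosed C)
    (hcv : Convex ℝ C) (x : X) : IsBestApprox C x (proj C x) := by
  have h : ∃ p, IsBestApprox C x p := by
    obtain ⟨p, hp, hmin⟩ := exists_norm_eq_iInf_of_complete_convex hne hcl.isComplete hcv x
    refine ⟨p, hp, fun c hc => ?_⟩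
    rw [hmin]
    exact ciInf_le ⟨0, by rintro _ ⟨w, rfl⟩; exact norm_nonneg _⟩ (⟨c, hc⟩ : C)
  unfold proj
  rw [dif_pos h]
  exact h.choose_spec

theorem IsBestApprox.eq_of_convex {C : Set X} (hcv : Convex ℝ C) {x p q : X}
    (hp : IsBestApprox C x p) (hq : IsBestApprox C x q) : p = q := by
  have hm : (1 / 2 : ℝ) • p + (1 / 2 : ℝ) • q ∈ C :=
    hcv hp.1 hq.1 (by norm_num) (by norm_num) (by norm_num)
  have h1 := hp.2 _ hm
  have h2 := hq.2 _ hp.1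
  have h3 := hp.2 _ hq.1
  have h4 : ‖x - p‖ = ‖x - q‖ := le_antisymm h3 h2
  have h5 := parallelogram_law_with_norm ℝ (x - p) (x - q)
  have h6 : (x - p) + (x - q) = (2 : ℝ) • (x - ((1 / 2 : ℝ) • p + (1 / 2 : ℝ) • q)) := by
    module
  have h7 : (x - p) - (x - q) = q - p := by abel
  rw [h6, h7, norm_smul, ← h4, Real.norm_of_nonneg (by norm_num : (0 : ℝ) ≤ 2)] at h5
  have h8 := norm_nonneg (x - p)
  have h9 : ‖q - p‖ = 0 := by
    have := norm_nonneg (q - p)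
    nlinarith
  exact (sub_eq_zero.mp (norm_eq_zero.mp h9)).symm

/-- The reflector `R_C = 2 P_C - Id`. -/
noncomputable def refl (C : Set X) (x : X) : X :=
  (2 : ℝ) • proj C x - x

/-- The Douglas–Rachford operator `T = Id - P_A + P_B R_A` of the ordered pair `(A, B)`. -/
noncomputable def drOp (A B : Set X) (x : X) : X :=
  x - proj A x + proj B (refl A x)

/-- The gap vector `g = P_{closure (B - A)} 0`, where `B - A` is the Minkowski difference. -/
noncomputable def gap (A B : Set X) : X :=
  proj (closure (B - A)) 0

/-- The set `E = A ∩ (B - g)`. -/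
def solE (A B : Set X) : Set X :=
  A ∩ (B - {gap A B})

/-- Weak convergence of a sequence: convergence in the weak topology of `X`. -/
def WeaklyTendsto (u : ℕ → X) (p : X) : Prop :=
  Filter.Tendsto (fun n => toWeakSpace ℝ X (u n)) Filter.atTop (𝓝 (toWeakSpace ℝ X p))

end Hilbert

/-- The horizontal axis `ℝ × {0}` in the Euclidean plane, as an affine subspace. -/
def axis : AffineSubspace ℝ (EuclideanSpace ℝ (Fin 2)) where
  carrier := {p | p 1 = 0}
  smul_vsub_vadd_mem' := by
    intro c p₁ p₂ p₃ h₁ h₂ h₃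
    simp_all

/-- The epigraph of `t ↦ |t| + 1` in the Euclidean plane. -/
def epiAbs : Set (EuclideanSpace ℝ (Fin 2)) :=
  {p | |p 0| + 1 ≤ p 1}

end DouglasRachford

namespace DouglasRachford

open Filter

/-! Write `g` for the gap vector and `E` for `solE A B`. If `e ∈ E`, then `e + n g` is an orbit of
`T` (`drOp_add_smul_gap`). Comparing it with `T^n x` through firm nonexpansiveness
(`norm_drOp_sub_sq_add_le`) shows that `z n = T^n x - n g` is Fejér monotone with respect to `E` and
that `T^(n+1) x - T^n x → g`.

Affinity of `A` enters through orthogonality: both `g` and `T^n x - P_A T^n x` are orthogonal to the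
direction of `A`, so `z n` and the shadow `a n = P_A T^n x` have the same inner products with that
direction. Hence the shadows are bounded, and `⟨a n, p - q⟩` converges for `p, q ∈ E`. Since `a n ∈
A` and `a n + (T^(n+1) x - T^n x) ∈ B`, weak cluster points lie in `E`; an Opial-type argument
(`exists_weaklyTendsto`) concludes. -/

theorem mem_solE {X : Type*} [NormedAddCommGroup X] {A B : Set X} {e : X} :
    e ∈ solE A B ↔ e ∈ A ∧ e + gap A B ∈ B := by
  simp only [solE, Set.mem_inter_iff, Set.sub_singleton, Set.mem_image]
  refine and_congr_right fun _ => ⟨?_, fun h => ⟨_, h, by abel⟩⟩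
  rintro ⟨b, hb, rfl⟩
  simpa using hb

section Hilbert

variable {X : Type*} [NormedAddCommGroup X] [InnerProductSpace ℝ X]

/-! ### Projections and firm nonexpansiveness -/

theorem isBestApprox_iff_inner_le_zero {C : Set X} (hcv : Convex ℝ C) {x p : X} (hp : p ∈ C) :
    IsBestApprox C x p ↔ ∀ c ∈ C, inner ℝ (x - p) (c - p) ≤ 0 := by
  rw [← norm_eq_iInf_iff_real_inner_le_zero hcv hp]
  have : Nonempty C := ⟨⟨p, hp⟩⟩
  have hbdd : BddBelow (Set.range fun w : C => ‖x - w‖) :=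
    ⟨0, by rintro _ ⟨w, rfl⟩; exact norm_nonneg _⟩
  constructor
  · intro h
    exact le_antisymm (le_ciInf fun w => h.2 w w.2) (ciInf_le hbdd (⟨p, hp⟩ : C))
  · intro h
    exact ⟨hp, fun c hc => h ▸ ciInf_le hbdd (⟨c, hc⟩ : C)⟩

theorem proj_eq_of_inner_le_zero {C : Set X} (hcv : Convex ℝ C) {x p : X} (hp : p ∈ C)
    (h : ∀ c ∈ C, inner ℝ (x - p) (c - p) ≤ 0) : proj C x = p := by
  have hbest := (isBestApprox_iff_inner_le_zero hcv hp).2 h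
  have hex : ∃ p, IsBestApprox C x p := ⟨p, hbest⟩
  rw [proj, dif_pos hex]
  exact IsBestApprox.eq_of_convex hcv hex.choose_spec hbest

theorem proj_of_mem {C : Set X} (hcv : Convex ℝ C) {x : X} (hx : x ∈ C) : proj C x = x :=
  proj_eq_of_inner_le_zero hcv hx fun c _ => by simp

theorem proj_affineSubspace_eq {A : AffineSubspace ℝ X} {x p : X} (hp : p ∈ A)
    (h : ∀ v ∈ A.direction, inner ℝ (x - p) v = 0) : proj (A : Set X) x = p :=
  proj_eq_of_inner_le_zero A.convex hp fun _ hc =>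
    (h _ (AffineSubspace.vsub_mem_direction hc hp)).le

variable [CompleteSpace X]

theorem proj_mem {C : Set X} (hne : C.Nonempty) (hcl : IsClosed C) (hcv : Convex ℝ C) (x : X) :
    proj C x ∈ C :=
  (isBestApprox_proj hne hcl hcv x).1

theorem inner_sub_proj_le_zero {C : Set X} (hne : C.Nonempty) (hcl : IsClosed C)
    (hcv : Convex ℝ C) (x : X) {c : X} (hc : c ∈ C) :
    inner ℝ (x - proj C x) (c - proj C x) ≤ 0 :=
  (isBestApprox_iff_inner_le_zero hcv (proj_mem hne hcl hcv x)).1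
    (isBestApprox_proj hne hcl hcv x) c hc

theorem inner_sub_proj_proj_sub_nonneg {C : Set X} (hne : C.Nonempty) (hcl : IsClosed C)
    (hcv : Convex ℝ C) (x y : X) :
    0 ≤ inner ℝ ((x - y) - (proj C x - proj C y)) (proj C x - proj C y) := by
  have h1 := inner_sub_proj_le_zero hne hcl hcv x (proj_mem hne hcl hcv y)
  have h2 := inner_sub_proj_le_zero hne hcl hcv y (proj_mem hne hcl hcv x)
  have h3 : inner ℝ ((x - y) - (proj C x - proj C y)) (proj C x - proj C y) =
      -(inner ℝ (x - proj C x) (proj C y - proj C x) +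
        inner ℝ (y - proj C y) (proj C x - proj C y)) := by
    simp only [inner_sub_left, inner_sub_right]
    ring
  linarith

/-- The Douglas–Rachford operator is firmly nonexpansive. -/
theorem norm_drOp_sub_sq_add_le {A B : Set X} (hA : A.Nonempty) (hAcl : IsClosed A)
    (hAcv : Convex ℝ A) (hB : B.Nonempty) (hBcl : IsClosed B) (hBcv : Convex ℝ B) (x y : X) :
    ‖drOp A B x - drOp A B y‖ ^ 2 + ‖(x - drOp A B x) - (y - drOp A B y)‖ ^ 2 ≤ ‖x - y‖ ^ 2 := by
  have h1 := inner_sub_proj_proj_sub_nonneg hA hAcl hAcv x y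
  have h2 := inner_sub_proj_proj_sub_nonneg hB hBcl hBcv (refl A x) (refl A y)
  have e1 : drOp A B x - drOp A B y = (x - y) - (proj A x - proj A y) +
      (proj B (refl A x) - proj B (refl A y)) := by
    simp only [drOp]; abel
  have e2 : (x - drOp A B x) - (y - drOp A B y) = (proj A x - proj A y) -
      (proj B (refl A x) - proj B (refl A y)) := by
    simp only [drOp]; abel
  have e3 : refl A x - refl A y = (2 : ℝ) • (proj A x - proj A y) - (x - y) := by
    simp only [refl]; module
  rw [e3] at h2
  rw [e1, e2]
  -- In the notation below, `‖d‖² - ‖d - p + r‖² - ‖p - r‖² = 2⟨d - p, p⟩ + 2⟨2p - d - r, r⟩`, which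
  -- is twice the sum of `h1` and `h2`.
  generalize x - y = d at *
  generalize proj A x - proj A y = p at *
  generalize proj B (refl A x) - proj B (refl A y) = r at *
  simp only [← real_inner_self_eq_norm_sq, inner_sub_left, inner_sub_right, inner_add_left,
    inner_add_right, inner_smul_left, RCLike.conj_to_real] at *
  have c1 := real_inner_comm d p
  have c2 := real_inner_comm d r
  have c3 := real_inner_comm p r
  linarith

theorem inner_sub_proj_direction {A : AffineSubspace ℝ X} (hA : (A : Set X).Nonempty)
    (hAcl : IsClosed (A : Set X)) (x : X) {v : X} (hv : v ∈ A.direction) :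
    inner ℝ (x - proj (A : Set X) x) v = 0 := by
  have hp := proj_mem hA hAcl A.convex x
  have key : ∀ w ∈ A.direction, inner ℝ (x - proj (A : Set X) x) w ≤ 0 := by
    intro w hw
    have hm := AffineSubspace.vadd_mem_of_mem_direction hw hp
    have h := inner_sub_proj_le_zero hA hAcl A.convex x hm
    simpa using h
  have h1 := key v hv
  have h2 := key (-v) (A.direction.neg_mem hv)
  rw [inner_neg_right] at h2
  linarith

/-! ### The gap vector -/

theorem inner_gap_le {A : AffineSubspace ℝ X} {B : Set X} (hBcv : Convex ℝ B)
    (hg : gap (A : Set X) B ∈ B - (A : Set X)) {a b : X} (ha : a ∈ A) (hb : b ∈ B) :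
    inner ℝ (gap (A : Set X) B) (gap (A : Set X) B) ≤ inner ℝ (gap (A : Set X) B) (b - a) := by
  have hcv : Convex ℝ (closure (B - (A : Set X))) := (hBcv.sub A.convex).closure
  have h := inner_sub_proj_le_zero ⟨_, subset_closure hg⟩ isClosed_closure hcv 0
    (subset_closure (Set.sub_mem_sub hb ha))
  change inner ℝ (0 - gap (A : Set X) B) (b - a - gap (A : Set X) B) ≤ 0 at h
  rw [zero_sub, inner_neg_left, inner_sub_right] at h
  linarith

/-- Translating the point of `A` along its direction keeps the difference in `B - A`, so the
variational inequality at `g` applies to `w` and `-w` alike. -/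
theorem inner_gap_direction {A : AffineSubspace ℝ X} {B : Set X} (hBcv : Convex ℝ B)
    (hg : gap (A : Set X) B ∈ B - (A : Set X)) {v : X} (hv : v ∈ A.direction) :
    inner ℝ (gap (A : Set X) B) v = 0 := by
  obtain ⟨b, hb, a, ha, hba⟩ := Set.mem_sub.1 hg
  have key : ∀ w ∈ A.direction, inner ℝ (gap (A : Set X) B) w ≤ 0 := by
    intro w hw
    have h := inner_gap_le hBcv hg (AffineSubspace.vadd_mem_of_mem_direction hw ha) hb
    rw [vadd_eq_add, show b - (w + a) = (b - a) - w by abel, hba, inner_sub_right] at h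
    linarith
  have h1 := key v hv
  have h2 := key (-v) (A.direction.neg_mem hv)
  rw [inner_neg_right] at h2
  linarith

/-- Orthogonality of `g` to `A` gives `P_A (e + n g) = e`, so the reflection is `e - n g`. Its
displacement from `e + g` is `-(n + 1) g`, which is normal to `B` there. -/
theorem drOp_add_smul_gap {A : AffineSubspace ℝ X} {B : Set X} (hBcv : Convex ℝ B)
    (hg : gap (A : Set X) B ∈ B - (A : Set X)) {e : X} (he : e ∈ solE (A : Set X) B) (n : ℕ) :
    drOp (A : Set X) B (e + (n : ℝ) • gap (A : Set X) B) =
      e + ((n + 1 : ℕ) : ℝ) • gap (A : Set X) B := by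
  obtain ⟨heA, heB⟩ := mem_solE.1 he
  have hpA : proj (A : Set X) (e + (n : ℝ) • gap (A : Set X) B) = e := by
    refine proj_affineSubspace_eq heA fun v hv => ?_
    rw [add_sub_cancel_left, inner_smul_left, inner_gap_direction hBcv hg hv, mul_zero]
  have hpB : proj B (refl (A : Set X) (e + (n : ℝ) • gap (A : Set X) B)) =
      e + gap (A : Set X) B := by
    refine proj_eq_of_inner_le_zero hBcv heB fun b hb => ?_
    have h := inner_gap_le hBcv hg heA hb
    rw [refl, hpA, show (2 : ℝ) • e - (e + (n : ℝ) • gap (A : Set X) B) -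
      (e + gap (A : Set X) B) = (-((n : ℝ) + 1)) • gap (A : Set X) B by module,
      inner_smul_left, ← sub_sub, inner_sub_right, RCLike.conj_to_real, neg_mul,
      Left.neg_nonpos_iff]
    exact mul_nonneg (by positivity) (sub_nonneg.2 h)
  rw [drOp, hpA, hpB]
  push_cast
  module

/-! ### Weak limits along ultrafilters -/

/-- A bounded family in a Hilbert space has a weak limit along every ultrafilter. -/
theorem exists_inner_tendsto_of_bounded {ι : Type*} (U : Ultrafilter ι) {u : ι → X} {M : ℝ}
    (hM : ∀ i, ‖u i‖ ≤ M) :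
    ∃ p, ∀ v, Tendsto (fun i => inner ℝ (u i) v) U (𝓝 (inner ℝ p v)) := by
  let f : ι → WeakDual ℝ X := fun i => StrongDual.toWeakDual (InnerProductSpace.toDual ℝ X (u i))
  have hK := WeakDual.isCompact_closedBall (𝕜 := ℝ) (E := X) 0 M
  obtain ⟨q, -, hq⟩ := hK.ultrafilter_le_nhds (U.map f) (by
    rw [le_principal_iff]
    refine Ultrafilter.mem_coe.2 (Ultrafilter.mem_map.2 (Filter.univ_mem' fun i => ?_))
    simpa [f] using hM i)
  refine ⟨(InnerProductSpace.toDual ℝ X).symm (WeakDual.toStrongDual q), fun v => ?_⟩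
  have hq' : Tendsto f U (𝓝 q) := hq
  have := ((WeakDual.eval_continuous v).tendsto q).comp hq'
  rw [InnerProductSpace.toDual_symm_apply]
  exact this

/-- Testing against `p - P_C p`, a normal of `C` at `P_C p`, forces `‖p - P_C p‖² ≤ 0`. -/
theorem mem_of_inner_tendsto {ι : Type*} {l : Filter ι} [l.NeBot] {C : Set X}
    (hcl : IsClosed C) (hcv : Convex ℝ C) {u : ι → X} {p : X} (hu : ∀ i, u i ∈ C)
    (h : ∀ v, Tendsto (fun i => inner ℝ (u i) v) l (𝓝 (inner ℝ p v))) : p ∈ C := by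
  obtain ⟨i, -⟩ := l.nonempty_of_mem univ_mem
  have hne : C.Nonempty := ⟨u i, hu i⟩
  have hlim : inner ℝ p (p - proj C p) ≤ inner ℝ (proj C p) (p - proj C p) := by
    refine le_of_tendsto (h _) (Eventually.of_forall fun j => ?_)
    have := inner_sub_proj_le_zero hne hcl hcv p (hu j)
    rw [real_inner_comm, inner_sub_left] at this
    linarith
  have h0 : inner ℝ (p - proj C p) (p - proj C p) ≤ 0 := by
    rw [inner_sub_left]
    linarith
  rw [sub_eq_zero.1 (inner_self_eq_zero.1 (le_antisymm h0 real_inner_self_nonneg))]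
  exact proj_mem hne hcl hcv p

theorem weaklyTendsto_of_inner {u : ℕ → X} {p : X}
    (h : ∀ v, Tendsto (fun n => inner ℝ (u n) v) atTop (𝓝 (inner ℝ p v))) :
    WeaklyTendsto u p := by
  have hinj : Function.Injective (topDualPairing ℝ X).flip := by
    intro x y hxy
    refine ext_inner_left ℝ fun v => ?_
    exact DFunLike.congr_fun hxy (InnerProductSpace.toDual ℝ X v)
  refine (WeakBilin.tendsto_iff_forall_eval_tendsto _ hinj).2 fun f => ?_
  have hf : ∀ x : X, f x = inner ℝ x ((InnerProductSpace.toDual ℝ X).symm f) := fun x => by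
    rw [real_inner_comm, InnerProductSpace.toDual_symm_apply]
  change Tendsto (fun n => f (u n)) atTop (𝓝 (f p))
  simpa only [hf] using h _

/-- A bounded sequence whose weak cluster points lie in a set on whose differences the sequence
converges weakly is weakly convergent to a point of that set. -/
theorem exists_weaklyTendsto {u : ℕ → X} {M : ℝ} {S : Set X} (hM : ∀ n, ‖u n‖ ≤ M)
    (hS : ∀ (U : Ultrafilter ℕ) (p : X), (U : Filter ℕ) ≤ atTop →
      (∀ v, Tendsto (fun n => inner ℝ (u n) v) U (𝓝 (inner ℝ p v))) → p ∈ S)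
    (hconv : ∀ p ∈ S, ∀ q ∈ S, ∃ c, Tendsto (fun n => inner ℝ (u n) (p - q)) atTop (𝓝 c)) :
    ∃ p ∈ S, WeaklyTendsto u p := by
  obtain ⟨p, hp⟩ := exists_inner_tendsto_of_bounded (Ultrafilter.of (atTop : Filter ℕ)) hM
  have hpS := hS _ p (Ultrafilter.of_le _) hp
  refine ⟨p, hpS, weaklyTendsto_of_inner fun v => ?_⟩
  rw [tendsto_iff_ultrafilter]
  intro U hU
  obtain ⟨q, hq⟩ := exists_inner_tendsto_of_bounded U hM
  have hqS := hS U q hU hq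
  obtain ⟨c, hc⟩ := hconv p hpS q hqS
  have h1 := tendsto_nhds_unique (hp (p - q)) (hc.mono_left (Ultrafilter.of_le _))
  have h2 := tendsto_nhds_unique (hq (p - q)) (hc.mono_left hU)
  -- Both weak limits give `p - q` the inner product `c`, so they coincide.
  have h3 : inner ℝ (p - q) (p - q) = 0 := by
    rw [inner_sub_left, h1, h2, sub_self]
  rw [sub_eq_zero.1 (inner_self_eq_zero.1 h3)]
  exact hq v

/-! ### The shadow sequence -/

/-- Weak convergence of the shadow sequence when the first set is an affine subspace. -/
theorem exists_weaklyTendsto_shadow (A : AffineSubspace ℝ X) (B : Set X)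
    (hA : (A : Set X).Nonempty) (hAcl : IsClosed (A : Set X)) (hB : B.Nonempty)
    (hBcl : IsClosed B) (hBcv : Convex ℝ B) (hg : gap (A : Set X) B ∈ B - (A : Set X)) (x : X) :
    ∃ p ∈ solE (A : Set X) B,
      WeaklyTendsto (fun n => proj (A : Set X) ((drOp (A : Set X) B)^[n] x)) p := by
  set g := gap (A : Set X) B with hgdef
  set T := drOp (A : Set X) B with hT
  set a : ℕ → X := fun n => proj (A : Set X) (T^[n] x) with ha
  set z : ℕ → X := fun n => T^[n] x - (n : ℝ) • g with hz
  have haA : ∀ n, a n ∈ A := fun n => proj_mem hA hAcl A.convex _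
  have hstep : ∀ e ∈ solE (A : Set X) B, ∀ n,
      ‖z (n + 1) - e‖ ^ 2 + ‖T^[n + 1] x - T^[n] x - g‖ ^ 2 ≤ ‖z n - e‖ ^ 2 := by
    intro e he n
    have h := norm_drOp_sub_sq_add_le hA hAcl A.convex hB hBcl hBcv (T^[n] x) (e + (n : ℝ) • g)
    rw [drOp_add_smul_gap hBcv hg he, ← hT, ← hgdef, ← Function.iterate_succ_apply' T] at h
    rw [norm_sub_rev (_ - _) g]
    have e1 : z (n + 1) - e = T^[n + 1] x - (e + ((n + 1 : ℕ) : ℝ) • g) := by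
      simp only [hz]; abel
    have e2 : g - (T^[n + 1] x - T^[n] x) =
        T^[n] x - T^[n + 1] x - (e + (n : ℝ) • g - (e + ((n + 1 : ℕ) : ℝ) • g)) := by
      push_cast; module
    have e3 : z n - e = T^[n] x - (e + (n : ℝ) • g) := by simp only [hz]; abel
    rw [e1, e2, e3]
    exact h
  have hanti : ∀ e ∈ solE (A : Set X) B, Antitone fun n => ‖z n - e‖ ^ 2 := fun e he =>
    antitone_nat_of_succ_le fun n =>
      (le_add_of_nonneg_right (sq_nonneg _)).trans (hstep e he n)
  have hconv : ∀ e ∈ solE (A : Set X) B, ∃ c,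
      Tendsto (fun n => ‖z n - e‖ ^ 2) atTop (𝓝 c) := fun e he =>
    ⟨_, tendsto_atTop_ciInf (hanti e he) ⟨0, by rintro _ ⟨n, rfl⟩; positivity⟩⟩
  obtain ⟨b₀, hb₀, e₀, he₀A, hbe⟩ := Set.mem_sub.1 hg
  have he₀ : e₀ ∈ solE (A : Set X) B := mem_solE.2 ⟨he₀A, by
    rw [← hgdef, ← hbe, add_sub_cancel]; exact hb₀⟩
  have hdiff : Tendsto (fun n => T^[n + 1] x - T^[n] x - g) atTop (𝓝 0) := by
    obtain ⟨c, hc⟩ := hconv e₀ he₀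
    have h0 : Tendsto (fun n => ‖z n - e₀‖ ^ 2 - ‖z (n + 1) - e₀‖ ^ 2) atTop (𝓝 0) := by
      simpa using hc.sub (hc.comp (tendsto_add_atTop_nat 1))
    have h1 := squeeze_zero (fun n => sq_nonneg ‖T^[n + 1] x - T^[n] x - g‖)
      (fun n => by linarith [hstep e₀ he₀ n]) h0
    rw [tendsto_zero_iff_norm_tendsto_zero]
    simpa using h1.sqrt
  have horth : ∀ n, ∀ v ∈ A.direction, inner ℝ (z n) v = inner ℝ (a n) v := by
    intro n v hv
    have h := inner_sub_proj_direction hA hAcl (T^[n] x) hv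
    rw [inner_sub_left, sub_eq_zero] at h
    rw [inner_sub_left, inner_smul_left, inner_gap_direction hBcv hg hv, mul_zero, sub_zero, h]
  have hbound : ∀ n, ‖a n‖ ≤ ‖z 0 - e₀‖ + ‖e₀‖ := by
    intro n
    have h1 : ‖z n - e₀‖ ^ 2 ≤ ‖z 0 - e₀‖ ^ 2 := hanti e₀ he₀ (Nat.zero_le n)
    -- Pythagoras: `z n - a n` is orthogonal to the direction of `A`, which contains `a n - e₀`.
    have h2 : ‖a n - e₀‖ ^ 2 ≤ ‖z n - e₀‖ ^ 2 := by
      have hv : a n - e₀ ∈ A.direction := AffineSubspace.vsub_mem_direction (haA n) he₀A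
      have h3 := norm_add_sq_eq_norm_sq_add_norm_sq_real (x := z n - a n) (y := a n - e₀)
        (by rw [inner_sub_left, horth n _ hv, sub_self])
      rw [sub_add_sub_cancel] at h3
      nlinarith [mul_self_nonneg ‖z n - a n‖]
    have h4 := (sq_le_sq₀ (norm_nonneg _) (norm_nonneg _)).1 (h2.trans h1)
    calc ‖a n‖ = ‖(a n - e₀) + e₀‖ := by rw [sub_add_cancel]
      _ ≤ ‖a n - e₀‖ + ‖e₀‖ := norm_add_le _ _
      _ ≤ _ := by linarith
  refine exists_weaklyTendsto hbound (fun U p hU hp => mem_solE.2 ⟨?_, ?_⟩) fun p hp q hq => ?_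
  · exact mem_of_inner_tendsto hAcl A.convex haA hp
  · refine mem_of_inner_tendsto (l := (U : Filter ℕ))
      (u := fun n => a n + (T^[n + 1] x - T^[n] x - g) + g) hBcl hBcv (fun n => ?_) fun v => ?_
    · have e : a n + (T^[n + 1] x - T^[n] x - g) + g = proj B (refl (A : Set X) (T^[n] x)) := by
        rw [Function.iterate_succ_apply', hT, drOp]
        abel
      rw [e]
      exact proj_mem hB hBcl hBcv _
    · have h := ((hp v).add ((hdiff.mono_left hU).inner
        (tendsto_const_nhds (x := v)))).add
        (tendsto_const_nhds (x := inner ℝ g v))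
      simpa only [inner_add_left, inner_zero_left, add_zero] using h
  · obtain ⟨c, hc⟩ := hconv p hp
    obtain ⟨d, hd⟩ := hconv q hq
    have hv : p - q ∈ A.direction :=
      AffineSubspace.vsub_mem_direction (mem_solE.1 hp).1 (mem_solE.1 hq).1
    -- Polarization: `2⟨z n, p - q⟩ = ‖z n - q‖² - ‖z n - p‖² + ‖p‖² - ‖q‖²`.
    refine ⟨_, (((hd.sub hc).add_const (‖p‖ ^ 2 - ‖q‖ ^ 2)).div_const 2).congr fun n => ?_⟩
    rw [← horth n _ hv, norm_sub_sq_real (z n) p, norm_sub_sq_real (z n) q, inner_sub_right]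
    ring

end Hilbert

/-! ### The planar example -/

theorem mem_axis {p : EuclideanSpace ℝ (Fin 2)} :
    p ∈ (axis : Set (EuclideanSpace ℝ (Fin 2))) ↔ p 1 = 0 :=
  Iff.rfl

theorem isClosed_axis : IsClosed (axis : Set (EuclideanSpace ℝ (Fin 2))) :=
  isClosed_eq (by fun_prop) continuous_const

theorem isClosed_epiAbs : IsClosed epiAbs :=
  isClosed_le (by fun_prop) (by fun_prop)

theorem convex_epiAbs : Convex ℝ epiAbs := by
  intro p hp q hq a b ha hb hab
  simp only [epiAbs, Set.mem_ofPred_eq, PiLp.add_apply, PiLp.smul_apply, smul_eq_mul] at *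
  have h := abs_add_le (a * p 0) (b * q 0)
  rw [abs_mul, abs_mul, abs_of_nonneg ha, abs_of_nonneg hb] at h
  nlinarith [mul_le_mul_of_nonneg_left hp ha, mul_le_mul_of_nonneg_left hq hb]

theorem mem_epiAbs_of_one_le {t : ℝ} (ht : 1 ≤ t) : !₂[0, t] ∈ epiAbs := by
  simpa [epiAbs] using ht

theorem epiAbs_sub_axis :
    epiAbs - (axis : Set (EuclideanSpace ℝ (Fin 2))) = {p | 1 ≤ p 1} := by
  ext p
  constructor
  · rintro ⟨b, hb, a, ha, rfl⟩
    simp only [epiAbs, Set.mem_ofPred_eq] at hb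
    have := abs_nonneg (b 0)
    simp only [Set.mem_ofPred_eq, PiLp.sub_apply, mem_axis.1 ha]
    linarith
  · intro hp
    refine ⟨_, mem_epiAbs_of_one_le hp, !₂[-p 0, 0], mem_axis.2 (by simp), ?_⟩
    ext i
    fin_cases i <;> simp

theorem gap_axis_epiAbs_mem :
    gap (axis : Set (EuclideanSpace ℝ (Fin 2))) epiAbs ∈
      epiAbs - (axis : Set (EuclideanSpace ℝ (Fin 2))) := by
  have hcl : IsClosed (epiAbs - (axis : Set (EuclideanSpace ℝ (Fin 2)))) := by
    rw [epiAbs_sub_axis]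
    exact isClosed_le (by fun_prop) (by fun_prop)
  have hne : (epiAbs - (axis : Set (EuclideanSpace ℝ (Fin 2)))).Nonempty :=
    ⟨!₂[0, 1], by simp [epiAbs_sub_axis]⟩
  rw [gap, hcl.closure_eq]
  exact proj_mem hne hcl (convex_epiAbs.sub axis.convex) 0

theorem axis_inter_epiAbs : (axis : Set (EuclideanSpace ℝ (Fin 2))) ∩ epiAbs = ∅ := by
  refine Set.eq_empty_of_forall_notMem fun p hp => ?_
  have h : |p 0| + 1 ≤ p 1 := hp.2
  rw [mem_axis.1 hp.1] at h
  linarith [abs_nonneg (p 0)]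

theorem proj_axis (s t : ℝ) :
    proj (axis : Set (EuclideanSpace ℝ (Fin 2))) !₂[s, t] = !₂[s, 0] := by
  refine proj_eq_of_inner_le_zero axis.convex (mem_axis.2 (by simp)) fun c hc => ?_
  simp [PiLp.inner_apply, Fin.sum_univ_two, mem_axis.1 hc]

/-- The hypothesis says that `(s, t)` lies in the translate to the apex `(0, 1)` of the normal cone
there. -/
theorem proj_epiAbs {s t : ℝ} (h : |s| ≤ 1 - t) : proj epiAbs !₂[s, t] = !₂[0, 1] := by
  refine proj_eq_of_inner_le_zero convex_epiAbs (mem_epiAbs_of_one_le le_rfl) fun c hc => ?_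
  have hc' : |c 0| + 1 ≤ c 1 := hc
  have h1 : s * c 0 ≤ |s| * |c 0| := (le_abs_self _).trans (abs_mul _ _).le
  have h2 : |s| * |c 0| ≤ (1 - t) * (c 1 - 1) :=
    mul_le_mul h (by linarith) (abs_nonneg _) ((abs_nonneg _).trans h)
  simp [PiLp.inner_apply, Fin.sum_univ_two]
  linarith

/-- Reflection in the axis flips the sign of `t`, turning the hypothesis into that of `proj_epiAbs`;
every such point is thus sent to the vertical axis in one step. -/
theorem drOp_axis_epiAbs {s t : ℝ} (h : |s| ≤ 1 + t) :
    drOp (axis : Set (EuclideanSpace ℝ (Fin 2))) epiAbs !₂[s, t] = !₂[0, t + 1] := by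
  have hr : refl (axis : Set (EuclideanSpace ℝ (Fin 2))) !₂[s, t] = !₂[s, -t] := by
    rw [refl, proj_axis]
    ext i
    fin_cases i <;> simp
    ring
  rw [drOp, proj_axis, hr, proj_epiAbs (by linarith)]
  ext i
  fin_cases i <;> simp

theorem drOp_axis_epiAbs_iterate {α : ℝ} (hα : α ∈ Set.Icc (-1 : ℝ) 1) {n : ℕ} (hn : 1 ≤ n) :
    (drOp (axis : Set (EuclideanSpace ℝ (Fin 2))) epiAbs)^[n] !₂[α, 0] = !₂[0, (n : ℝ)] := by
  induction n, hn using Nat.le_induction with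
  | base =>
    rw [Function.iterate_one, drOp_axis_epiAbs (by simpa using abs_le.2 hα)]
    simp
  | succ n hn ih =>
    rw [Function.iterate_succ_apply', ih, drOp_axis_epiAbs (by rw [abs_zero]; positivity)]
    push_cast
    rfl

theorem norm_proj_drOp_axis_epiAbs_iterate {α : ℝ} (hα : α ∈ Set.Icc (-1 : ℝ) 1) {n : ℕ}
    (hn : 1 ≤ n) :
    ‖proj epiAbs ((drOp (axis : Set (EuclideanSpace ℝ (Fin 2))) epiAbs)^[n] !₂[α, 0])‖ = n := by
  rw [drOp_axis_epiAbs_iterate hα hn,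
    proj_of_mem convex_epiAbs (mem_epiAbs_of_one_le (by exact_mod_cast hn))]
  simp [EuclideanSpace.norm_eq, Fin.sum_univ_two, Real.sqrt_sq]

theorem drOp_univ {X : Type*} [NormedAddCommGroup X] [InnerProductSpace ℝ X] :
    drOp (Set.univ : Set X) Set.univ = id := by
  have h : ∀ x : X, proj Set.univ x = x := fun x => proj_of_mem convex_univ (Set.mem_univ x)
  funext x
  simp only [drOp, refl, h, id, two_smul]
  abel

end DouglasRachford

theorem theorem2p3 {X : Type*} [NormedAddCommGroup X] [InnerProductSpace ℝ X] [CompleteSpace X] :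
    -- Part (i): weak convergence of the shadow sequence.
    (∀ (A : AffineSubspace ℝ X) (B : Set X),
      (A : Set X).Nonempty → IsClosed (A : Set X) →
      B.Nonempty → IsClosed B → Convex ℝ B →
      DouglasRachford.gap (A : Set X) B ∈ B - (A : Set X) →
      ∀ x : X, ∃ p ∈ DouglasRachford.solE (A : Set X) B,
        DouglasRachford.WeaklyTendsto
          (fun n => DouglasRachford.proj (A : Set X) ((DouglasRachford.drOp (A : Set X) B)^[n] x))
          p) ∧
    -- Part (ii), a bounded instance: A = B = X.
    (IsClosed ((⊤ : AffineSubspace ℝ X) : Set X) ∧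
      DouglasRachford.gap ((⊤ : AffineSubspace ℝ X) : Set X) Set.univ ∈
        (Set.univ : Set X) - ((⊤ : AffineSubspace ℝ X) : Set X) ∧
      ∀ x : X, Bornology.IsBounded (Set.range fun n : ℕ =>
        DouglasRachford.proj Set.univ
          ((DouglasRachford.drOp ((⊤ : AffineSubspace ℝ X) : Set X) Set.univ)^[n] x))) ∧
    -- Part (ii), an unbounded instance in the plane: A = ℝ × {0} and B = epi(|·| + 1).
    (IsClosed (DouglasRachford.axis : Set (EuclideanSpace ℝ (Fin 2))) ∧
      DouglasRachford.epiAbs.Nonempty ∧ IsClosed DouglasRachford.epiAbs ∧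
      Convex ℝ DouglasRachford.epiAbs ∧
      DouglasRachford.gap (DouglasRachford.axis : Set (EuclideanSpace ℝ (Fin 2)))
          DouglasRachford.epiAbs ∈
        DouglasRachford.epiAbs - (DouglasRachford.axis : Set (EuclideanSpace ℝ (Fin 2))) ∧
      (DouglasRachford.axis : Set (EuclideanSpace ℝ (Fin 2))) ∩ DouglasRachford.epiAbs = ∅ ∧
      ∀ α ∈ Set.Icc (-1 : ℝ) 1,
        (∀ n : ℕ, 1 ≤ n →
          (DouglasRachford.drOp (DouglasRachford.axis : Set (EuclideanSpace ℝ (Fin 2)))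
              DouglasRachford.epiAbs)^[n] !₂[α, 0] = !₂[0, (n : ℝ)] ∧
          (!₂[0, (n : ℝ)] : EuclideanSpace ℝ (Fin 2)) ∈ DouglasRachford.epiAbs ∧
          ‖DouglasRachford.proj DouglasRachford.epiAbs
            ((DouglasRachford.drOp (DouglasRachford.axis : Set (EuclideanSpace ℝ (Fin 2)))
              DouglasRachford.epiAbs)^[n] !₂[α, 0])‖ = n) ∧
        Filter.Tendsto (fun n : ℕ => ‖DouglasRachford.proj DouglasRachford.epiAbs
            ((DouglasRachford.drOp (DouglasRachford.axis : Set (EuclideanSpace ℝ (Fin 2)))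
              DouglasRachford.epiAbs)^[n] !₂[α, 0])‖)
          Filter.atTop Filter.atTop) := by
  refine ⟨DouglasRachford.exists_weaklyTendsto_shadow, ⟨isClosed_univ, ?_, fun x => ?_⟩,
    DouglasRachford.isClosed_axis, ⟨_, DouglasRachford.mem_epiAbs_of_one_le le_rfl⟩,
    DouglasRachford.isClosed_epiAbs, DouglasRachford.convex_epiAbs,
    DouglasRachford.gap_axis_epiAbs_mem, DouglasRachford.axis_inter_epiAbs,
    fun α hα => ⟨fun n hn => ⟨DouglasRachford.drOp_axis_epiAbs_iterate hα hn,
      DouglasRachford.mem_epiAbs_of_one_le (by exact_mod_cast hn),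
      DouglasRachford.norm_proj_drOp_axis_epiAbs_iterate hα hn⟩, ?_⟩⟩
  · exact ⟨_, Set.mem_univ _, 0, Set.mem_univ _, sub_zero _⟩
  · rw [AffineSubspace.top_coe, DouglasRachford.drOp_univ]
    simp only [Function.iterate_id, id]
    exact Bornology.isBounded_singleton.subset Set.range_const_subset
  · refine tendsto_natCast_atTop_atTop.congr' ?_
    filter_upwards [Filter.eventually_ge_atTop 1] with n hn
    exact (DouglasRachford.norm_proj_drOp_axis_epiAbs_iterate hα hn).symm
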